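/- Let $d\ge 1$ and let $[n]=\{1,\dots,n\}$ with its natural order. A $d$-tournament on $[n]$ is a map $\epsilon:\binom{[n]}{d+1}\to\{-1,1\}$. For $\sigma=\{i_0<\dots<i_d\}$ and $\tau=\sigma\setminus\{i_j\}$ put $(\tau;\sigma)=(-1)^{d-j}$, and put $(\tau;\sigma)=0$ for a $d$-subset $\tau\not\subset\sigma$. The incidence matrix $A$ of the tournament is the real $\binom nd\times\binom n{d+1}$ matrix, with rows indexed by $d$-subsets $\tau$ and columns by $(d+1)$-subsets $\sigma$ of $[n]$, whose $(\tau,\sigma)$ entry is $\epsilon_\sigma\cdot(\tau;\sigma)$. A non-empty set $C$ of $(d+1)$-subsets is a cycle if there is a real vector $v\ge 0$ with $Av=0$ whose support is $C$; the tournament is acyclic if it has no cycle. Let $a_d(n)$ be the number of acyclic $d$-tournaments on $[n]$. 1. For every integer $d\ge1$ and every sufficiently large $n$ (depending on $d$), $$a_d(n)\le\left(\frac{e}{d+1}\,n\right)^{\binom nd}.$$ 2. For every integer $d\ge1$, with $H_d=\sum_{k=1}^d\frac1k$, there is a sequence $\eta_n\to0$ (depending on $d$) with $e^{H_d}+\eta_n>0$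 and $$a_d(n)\ge\left(\frac{n}{e^{H_d}+\eta_n}\right)^{\binom nd}\qquad\text{for all } n.$$ 3. There is a sequence $\delta_d\to0$ such that for every $d\ge1$ and every sufficiently large $n$ (depending on $d$), $$a_d(n)\ge\left(\frac{e^{-\gamma}+\delta_d}{d}\,n\right)^{\binom nd},$$ where $\gamma$ is the Euler constant. -/

import Mathlib

open Filter Topology Matrix

/-- The `k`-element subsets of `V`, i.e. the faces of dimension `k - 1`. -/
abbrev Face (V : Type*) (k : ℕ) : Type _ := {s : Finset V // s.card = k}

/-- A `d`-tournament on `V`: an orientation `ε σ ∈ {1, -1}` of every `(d+1)`-subset `σ` of `V`. -/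
structure HTournament (V : Type*) (d : ℕ) where
  ε : Face V (d + 1) → ℤˣ

/-- The sign `(τ; σ)`: if `σ = {i₀ < ⋯ < i_d}` and `τ = σ \ {i_j}` it is `(-1)^(d-j)`, and it is
`0` if `τ` is not contained in `σ` (at most one summand is nonzero). -/
def inducedSign {V : Type*} [LinearOrder V] {d : ℕ} (τ : Face V d) (σ : Face V (d + 1)) : ℤ :=
  ∑ j : Fin (d + 1), if τ.1 = σ.1.erase (σ.1.orderEmbOfFin σ.2 j) then (-1) ^ (d - (j : ℕ)) else 0

namespace HTournament

/-- The incidence matrix: rows are the `d`-subsets, columns the `(d+1)`-subsets of `V`, and the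
`(τ, σ)` entry is the orientation induced by `σ` on `τ`. -/
def incidenceMatrix {V : Type*} [LinearOrder V] {d : ℕ} (T : HTournament V d) :
    Matrix (Face V d) (Face V (d + 1)) ℝ :=
  Matrix.of fun τ σ => (((T.ε σ : ℤ) * inducedSign τ σ : ℤ) : ℝ)

/-- A nonempty set `C` of `d`-faces is a cycle if it is the support of a nonnegative real vector
in the kernel of the incidence matrix. -/
def IsCycle {V : Type*} [LinearOrder V] [Fintype V] {d : ℕ} (T : HTournament V d)
    (C : Finset (Face V (d + 1))) : Prop :=
  C.Nonempty ∧ ∃ v : Face V (d + 1) → ℝ,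
    (∀ σ, 0 ≤ v σ) ∧ T.incidenceMatrix *ᵥ v = 0 ∧ ∀ σ, 0 < v σ ↔ σ ∈ C

def IsAcyclic {V : Type*} [LinearOrder V] [Fintype V] {d : ℕ} (T : HTournament V d) : Prop :=
  ∀ C : Finset (Face V (d + 1)), ¬ T.IsCycle C

end HTournament

/-- `a_d(n)`: the number of acyclic `d`-tournaments on the vertex set `{0 < 1 < ⋯ < n-1}`. -/
noncomputable def numAcyclic (d n : ℕ) : ℕ :=
  Nat.card {T : HTournament (Fin n) d // T.IsAcyclic}

/-!
Let `∂σ` be the simplicial boundary of a `d`-face `σ`. A tournament `ε` is acyclic exactly when the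
vectors `ε σ • ∂σ` admit no nontrivial vanishing combination with nonnegative coefficients, so
`a_d(n)` counts the acyclic reorientations of the vector configuration of all `∂σ`.

*Upper bound.* If the acyclic reorientations realize every sign pattern on a set `S` of faces, then
the `∂σ` with `σ ∈ S` are linearly independent: the signs of the coefficients of a dependence would
be a pattern with a cycle. Hence `S` has at most `C(n, d)` elements, and the Sauer–Shelah lemma
gives `a_d(n) ≤ ∑ k ≤ C(n, d), C(C(n, d + 1), k)`.

*Lower bound.* The faces through a new vertex correspond to those of its link. An acyclic tournament
on the old vertices and an acyclic link glue to an acyclic tournament, since the incidence matrix is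
block triangular, so `a_{d+1}(n + 1) ≥ a_{d+1}(n) a_d(n)`. Starting from `a_1(n) ≥ n!`, given by the
tournaments of linear orders, this yields `log a_d(n) ≥ C(n, d) (log (n - d + 1) - H_d)` by
induction, and `H_d - log d → γ`.
-/

section PositivelyIndependent

variable {𝕜 E F G ι κ μ : Type*} [Fintype ι] [Fintype κ] [Fintype μ]

/-- A finite family of vectors is positively independent if its only vanishing combination with
nonnegative coefficients is the trivial one. For the columns of the incidence matrix of a
tournament this is acyclicity. -/
def PositivelyIndependent (𝕜 : Type*) [Semiring 𝕜] [LE 𝕜] [AddCommMonoid E] [Module 𝕜 E]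
    (w : ι → E) : Prop :=
  ∀ v : ι → 𝕜, 0 ≤ v → ∑ i, v i • w i = 0 → v = 0

namespace PositivelyIndependent

section Semiring

variable [Semiring 𝕜] [AddCommMonoid E] [Module 𝕜 E] [AddCommMonoid F] [Module 𝕜 F]
  [AddCommMonoid G] [Module 𝕜 G]

lemma of_forall_pos [PartialOrder 𝕜] [IsStrictOrderedRing 𝕜] {w : ι → E} (y : E →ₗ[𝕜] 𝕜)
    (hy : ∀ i, 0 < y (w i)) : PositivelyIndependent 𝕜 w := by
  intro v hv hsum
  have hysum : ∑ i, v i * y (w i) = 0 := by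
    simpa only [map_sum, map_smul, smul_eq_mul, map_zero] using congrArg y hsum
  have hterm := (Finset.sum_eq_zero_iff_of_nonneg
    fun i _ => mul_nonneg (hv i) (hy i).le).1 hysum
  funext i
  by_contra hi
  exact (mul_pos ((hv i).lt_of_ne' hi) (hy i)).ne' (hterm i (Finset.mem_univ i))

variable [LE 𝕜]

lemma comp_equiv_iff (e : ι ≃ κ) {w : κ → E} :
    PositivelyIndependent 𝕜 (w ∘ e) ↔ PositivelyIndependent 𝕜 w := by
  constructor
  · intro h v hv hsum
    have hve : v ∘ e = 0 := h _ (fun i => hv (e i)) ((e.sum_comp fun j => v j • w j).trans hsum)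
    funext j
    simpa using congrFun hve (e.symm j)
  · intro h v hv hsum
    have hve : v ∘ e.symm = 0 := by
      refine h _ (fun j => hv (e.symm j)) ?_
      rw [← hsum, ← e.sum_comp]
      simp only [Function.comp_apply, e.symm_apply_apply]
    funext i
    simpa using congrFun hve (e i)

/-- The matrix of such a family is block triangular: `f` sees only the `κ`-part, and once its
coefficients vanish, `g` sees the `ι`-part. -/
lemma of_sum {w : ι ⊕ κ → E} (g : E →ₗ[𝕜] F) (f : E →ₗ[𝕜] G)
    (hg : PositivelyIndependent 𝕜 fun i => g (w (.inl i)))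
    (hf₀ : ∀ i, f (w (.inl i)) = 0) (hf : PositivelyIndependent 𝕜 fun j => f (w (.inr j))) :
    PositivelyIndependent 𝕜 w := by
  intro v hv hsum
  rw [Fintype.sum_sum_type] at hsum
  have hκ : v ∘ Sum.inr = 0 := hf _ (fun j => hv (.inr j)) <| by
    simpa [map_sum, hf₀] using congrArg f hsum
  have hι : v ∘ Sum.inl = 0 := hg _ (fun i => hv (.inl i)) <| by
    simpa [map_sum, fun j => show v (.inr j) = 0 from congrFun hκ j] using congrArg g hsum
  funext x
  rcases x with i | j
  exacts [congrFun hι i, congrFun hκ j]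

end Semiring

end PositivelyIndependent

/-- The sign vectors `ε` for which the family `ε i • a i` is positively independent: in the language
of oriented matroids, the acyclic reorientations of the vector configuration `a`. -/
def acyclicReorientations (𝕜 : Type*) [Ring 𝕜] [LE 𝕜] [AddCommGroup E] [Module 𝕜 E] (a : ι → E) :
    Set (ι → ℤˣ) :=
  {ε | PositivelyIndependent 𝕜 fun i => ε i • a i}

section Product

variable [Ring 𝕜] [LE 𝕜] [AddCommGroup E] [Module 𝕜 E] [AddCommGroup F] [Module 𝕜 F]
  [AddCommGroup G] [Module 𝕜 G]

lemma ncard_acyclicReorientations_mul_le {a : μ → E} (e : ι ⊕ κ ≃ μ) (g : E →ₗ[𝕜] F)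
    (f : E →ₗ[𝕜] G) (hf₀ : ∀ i, f (a (e (.inl i))) = 0) :
    (acyclicReorientations 𝕜 fun i => g (a (e (.inl i)))).ncard *
        (acyclicReorientations 𝕜 fun j => f (a (e (.inr j)))).ncard ≤
      (acyclicReorientations 𝕜 a).ncard := by
  let glue : (ι → ℤˣ) × (κ → ℤˣ) ≃ (μ → ℤˣ) :=
    (Equiv.sumArrowEquivProdArrow ι κ ℤˣ).symm.trans (e.arrowCongr (Equiv.refl ℤˣ))
  rw [← Set.ncard_prod]
  refine Set.ncard_le_ncard_of_injOn glue ?_ glue.injective.injOn (Set.toFinite _)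
  rintro ⟨ε, ε'⟩ ⟨hε, hε'⟩
  have hglue : (fun m => glue (ε, ε') m • a m) ∘ e =
      fun x => Sum.elim ε ε' x • a (e x) := by
    funext x
    simp only [glue, Function.comp_apply, Equiv.trans_apply, Equiv.arrowCongr_apply,
      Equiv.symm_apply_apply, Equiv.coe_refl, id_eq]
    rfl
  refine (PositivelyIndependent.comp_equiv_iff e).1 ?_
  rw [hglue]
  refine PositivelyIndependent.of_sum g f ?_ (fun i => ?_) ?_
  · simp only [LinearMap.map_smul_of_tower, Sum.elim_inl]
    exact hε
  · rw [LinearMap.map_smul_of_tower, hf₀, smul_zero]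
  · simp only [LinearMap.map_smul_of_tower, Sum.elim_inr]
    exact hε'

end Product

section Sign

variable [Ring 𝕜] [LinearOrder 𝕜] [IsStrictOrderedRing 𝕜] [AddCommGroup E] [Module 𝕜 E]

lemma sign_mem_acyclicReorientations {a : ι → E} (y : E →ₗ[𝕜] 𝕜) (hy : ∀ i, y (a i) ≠ 0) :
    (fun i => if 0 < y (a i) then 1 else -1) ∈ acyclicReorientations 𝕜 a := by
  refine PositivelyIndependent.of_forall_pos y fun i => ?_
  simp only [LinearMap.map_smul_of_tower]
  split_ifs with h
  · rwa [one_smul]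
  · rw [Units.neg_smul, one_smul]
    exact neg_pos.2 ((not_lt.1 h).lt_of_ne (hy i))

/-- A linear dependence on `S` contradicts the acyclic reorientation that agrees on `S` with the
signs of its coefficients. -/
lemma linearIndepOn_of_forall_exists_acyclicReorientation {a : ι → E} {S : Finset ι}
    (h : ∀ δ : ι → ℤˣ, ∃ ε ∈ acyclicReorientations 𝕜 a, ∀ i ∈ S, ε i = δ i) :
    LinearIndepOn 𝕜 a (S : Set ι) := by
  classical
  rw [linearIndepOn_finset_iff]
  intro c hc i hi
  obtain ⟨ε, hε, hεS⟩ := h fun i => if 0 ≤ c i then 1 else -1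
  have habs : ∀ i ∈ S, |c i| • ε i • a i = c i • a i := fun i hi => by
    rw [hεS i hi]
    split_ifs with hci
    · rw [abs_of_nonneg hci, one_smul]
    · rw [abs_of_neg (not_le.1 hci), Units.neg_smul, one_smul, smul_neg, neg_smul, neg_neg]
  have hzero : (fun i => if i ∈ S then |c i| else 0) = 0 := by
    refine hε _ (fun i => ?_) ?_
    · dsimp only
      split_ifs
      exacts [abs_nonneg _, le_rfl]
    · simp only [ite_smul, zero_smul, Finset.sum_ite_mem, Finset.univ_inter]
      rw [Finset.sum_congr rfl habs, hc]
  simpa [hi] using congrFun hzero i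

end Sign

/-- The Sauer–Shelah lemma for families of sign vectors. -/
lemma ncard_le_sum_choose_of_forall_restrict {A : Set (ι → ℤˣ)} {r : ℕ}
    (h : ∀ S : Finset ι, (∀ δ : ι → ℤˣ, ∃ ε ∈ A, ∀ i ∈ S, ε i = δ i) → S.card ≤ r) :
    A.ncard ≤ ∑ k ∈ Finset.range (r + 1), (Fintype.card ι).choose k := by
  classical
  let pos : (ι → ℤˣ) → Finset ι := fun ε => {i | ε i = 1}
  have mem_pos : ∀ ε i, i ∈ pos ε ↔ ε i = 1 := by simp [pos]
  have eq_of_iff : ∀ u v : ℤˣ, (u = 1 ↔ v = 1) → u = v := by decide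
  have pos_injective : pos.Injective := fun ε ε' hεε' =>
    funext fun i => eq_of_iff _ _ <| by rw [← mem_pos, hεε', mem_pos]
  let 𝒜 : Finset (Finset ι) := A.toFinset.image pos
  have card_le_of_shatters : ∀ S, 𝒜.Shatters S → S.card ≤ r := fun S hS => h S fun δ => by
    obtain ⟨u, hu, hSu⟩ := hS (Finset.inter_subset_left (s₂ := pos δ))
    obtain ⟨ε, hε, rfl⟩ := Finset.mem_image.1 hu
    refine ⟨ε, Set.mem_toFinset.1 hε, fun i hi => eq_of_iff _ _ ?_⟩
    simpa [hi, mem_pos] using congrArg (i ∈ ·) hSu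
  calc A.ncard = 𝒜.card := by
        rw [Set.ncard_eq_toFinset_card', Finset.card_image_of_injective _ pos_injective]
    _ ≤ 𝒜.shatterer.card := 𝒜.card_le_card_shatterer
    _ ≤ ∑ k ∈ Finset.Iic 𝒜.vcDim, (Fintype.card ι).choose k :=
        Finset.card_shatterer_le_sum_vcDim
    _ ≤ ∑ k ∈ Finset.range (r + 1), (Fintype.card ι).choose k := by
        refine Finset.sum_le_sum_of_subset fun k hk => ?_
        have hvc : 𝒜.vcDim ≤ r :=
          Finset.sup_le fun S hS => card_le_of_shatters S (Finset.mem_shatterer.1 hS)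
        exact Finset.mem_range_succ_iff.2 ((Finset.mem_Iic.1 hk).trans hvc)

theorem ncard_acyclicReorientations_le [Field 𝕜] [LinearOrder 𝕜] [IsStrictOrderedRing 𝕜]
    [AddCommGroup E] [Module 𝕜 E] (a : ι → E) :
    (acyclicReorientations 𝕜 a).ncard ≤
      ∑ k ∈ Finset.range (Set.finrank 𝕜 (Set.range a) + 1), (Fintype.card ι).choose k := by
  refine ncard_le_sum_choose_of_forall_restrict fun S hS => ?_
  have hli : LinearIndependent 𝕜 fun i : S => a i :=
    linearIndepOn_of_forall_exists_acyclicReorientation hS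
  have hspan := finrank_span_eq_card hli
  rw [Fintype.card_coe] at hspan
  rw [← hspan]
  have := Module.Finite.span_of_finite 𝕜 (Set.finite_range a)
  exact Submodule.finrank_mono (Submodule.span_mono (Set.range_comp_subset_range _ a))

end PositivelyIndependent

section Faces

variable {V : Type*} [LinearOrder V] {d : ℕ}

lemma card_filter_orderEmbOfFin_lt (s : Finset V) (hs : s.card = d + 1) (j : Fin (d + 1)) :
    (s.filter (s.orderEmbOfFin hs j < ·)).card = d - j := by
  calc (s.filter (s.orderEmbOfFin hs j < ·)).card
      = ((Finset.univ.map (s.orderEmbOfFin hs).toEmbedding).filter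
          (s.orderEmbOfFin hs j < ·)).card := by rw [Finset.map_orderEmbOfFin_univ]
    _ = (Finset.Ioi j).card := by
        simp only [Finset.filter_map, Finset.card_map]
        congr 1
        ext i
        simp
    _ = d - j := by simp [Fin.card_Ioi]

lemma inducedSign_eq_sum (τ : Face V d) (σ : Face V (d + 1)) :
    inducedSign τ σ =
      ∑ x ∈ σ.1, if τ.1 = σ.1.erase x then (-1) ^ (σ.1.filter (x < ·)).card else 0 := by
  conv_rhs => rw [← Finset.map_orderEmbOfFin_univ σ.1 σ.2, Finset.sum_map,
    Finset.map_orderEmbOfFin_univ σ.1 σ.2]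
  simp only [RelEmbedding.coe_toEmbedding, card_filter_orderEmbOfFin_lt]
  rfl

lemma sum_inducedSign_mul [Fintype V] {R : Type*} [Ring R] (σ : Face V (d + 1))
    (y : Finset V → R) :
    ∑ τ : Face V d, (inducedSign τ σ : R) * y τ.1 =
      ∑ x ∈ σ.1, (-1) ^ (σ.1.filter (x < ·)).card * y (σ.1.erase x) := by
  simp only [inducedSign_eq_sum]
  push_cast
  simp only [Finset.sum_mul]
  rw [Finset.sum_comm]
  refine Finset.sum_congr rfl fun x hx => ?_
  have hcard : (σ.1.erase x).card = d := by
    rw [Finset.card_erase_of_mem hx, σ.2, Nat.add_sub_cancel]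
  rw [Fintype.sum_eq_single ⟨σ.1.erase x, hcard⟩ fun τ hτ => by
    rw [if_neg fun h => hτ (Subtype.ext h), zero_mul]]
  simp

end Faces
section Acyclicity

variable {V : Type*} [LinearOrder V] {d : ℕ}

/-- The column at `σ` of the incidence matrix of the all-positive tournament, as a vector: the
simplicial boundary of `σ`. -/
def Face.boundary (σ : Face V (d + 1)) : Face V d → ℝ :=
  fun τ => inducedSign τ σ

/-- A tournament is its sign vector. -/
def HTournament.signsEquiv (V : Type*) (d : ℕ) : HTournament V d ≃ (Face V (d + 1) → ℤˣ) where
  toFun := HTournament.ε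
  invFun := HTournament.mk

variable [Fintype V]

lemma HTournament.incidenceMatrix_mulVec (T : HTournament V d) (v : Face V (d + 1) → ℝ) :
    T.incidenceMatrix *ᵥ v = ∑ σ, v σ • T.ε σ • σ.boundary := by
  funext τ
  simp [Matrix.mulVec, dotProduct, incidenceMatrix, Face.boundary, Units.smul_def, mul_comm]

lemma HTournament.isAcyclic_iff (T : HTournament V d) :
    T.IsAcyclic ↔ T.ε ∈ acyclicReorientations ℝ Face.boundary := by
  constructor
  · intro h v hv hsum
    by_contra hne
    obtain ⟨σ, hσ⟩ := Function.ne_iff.1 hne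
    refine h {σ | 0 < v σ} ⟨⟨σ, by simpa using (hv σ).lt_of_ne' hσ⟩, v, hv, ?_, by simp⟩
    rw [T.incidenceMatrix_mulVec, hsum]
  · rintro h C ⟨⟨σ, hσ⟩, v, hv, hA, hC⟩
    have hv0 : v = 0 := h v hv (by rw [← T.incidenceMatrix_mulVec, hA])
    exact ((hC σ).2 hσ).ne' (congrFun hv0 σ)

lemma numAcyclic_eq_ncard (d n : ℕ) :
    numAcyclic d n =
      (acyclicReorientations ℝ (Face.boundary : Face (Fin n) (d + 1) → _)).ncard := by
  rw [numAcyclic, ← Nat.card_coe_set_eq]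
  exact Nat.card_congr ((HTournament.signsEquiv _ d).subtypeEquiv HTournament.isAcyclic_iff)

lemma card_face_fin (n k : ℕ) : Fintype.card (Face (Fin n) k) = n.choose k := by
  simp

theorem numAcyclic_le_sum_choose (d n : ℕ) :
    numAcyclic d n ≤ ∑ k ∈ Finset.range (n.choose d + 1), (n.choose (d + 1)).choose k := by
  have hrank : Set.finrank ℝ (Set.range (Face.boundary : Face (Fin n) (d + 1) → _)) ≤
      n.choose d := (Submodule.finrank_le _).trans (by simp)
  rw [numAcyclic_eq_ncard]
  refine (ncard_acyclicReorientations_le _).trans ?_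
  rw [card_face_fin]
  gcongr

end Acyclicity

section UpperBound

/-- Compare each binomial coefficient with a term of `(1 + x) ^ m ≤ exp (x * m)` at `x = r / m`. -/
lemma sum_range_choose_le_pow {m r : ℕ} (hr : 0 < r) (hrm : r ≤ m) :
    (∑ k ∈ Finset.range (r + 1), (m.choose k : ℝ)) ≤ (Real.exp 1 * m / r) ^ r := by
  have hm0 : (0 : ℝ) < m := by exact_mod_cast hr.trans_le hrm
  obtain ⟨x, hx⟩ : ∃ x : ℝ, x = r / m := ⟨_, rfl⟩
  have hx0 : 0 < x := hx ▸ by positivity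
  have hx1 : x ≤ 1 := by
    rw [hx, div_le_one hm0]
    exact_mod_cast hrm
  have hscaled : (∑ k ∈ Finset.range (r + 1), (m.choose k : ℝ)) * x ^ r ≤ Real.exp 1 ^ r := by
    calc (∑ k ∈ Finset.range (r + 1), (m.choose k : ℝ)) * x ^ r
        ≤ ∑ k ∈ Finset.range (r + 1), x ^ k * 1 ^ (m - k) * (m.choose k : ℝ) := by
          rw [Finset.sum_mul]
          refine Finset.sum_le_sum fun k hk => ?_
          rw [one_pow, mul_one, mul_comm]
          gcongr ?_ * _
          exact pow_le_pow_of_le_one hx0.le hx1 (Nat.lt_succ_iff.1 (Finset.mem_range.1 hk))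
      _ ≤ ∑ k ∈ Finset.range (m + 1), x ^ k * 1 ^ (m - k) * (m.choose k : ℝ) :=
          Finset.sum_le_sum_of_subset_of_nonneg
            (Finset.range_subset_range.2 (by gcongr)) fun k _ _ => by positivity
      _ = (x + 1) ^ m := (add_pow x 1 m).symm
      _ ≤ Real.exp x ^ m := pow_le_pow_left₀ (by positivity) (Real.add_one_le_exp x) m
      _ = Real.exp 1 ^ r := by
          rw [← Real.exp_nat_mul, ← Real.exp_nat_mul, hx, mul_div_cancel₀ _ hm0.ne', mul_one]
  rw [← le_div_iff₀ (by positivity), ← div_pow] at hscaled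
  rwa [hx, div_div_eq_mul_div] at hscaled

theorem numAcyclic_le {d n : ℕ} (hn : 2 * d + 1 ≤ n) :
    (numAcyclic d n : ℝ) ≤ (Real.exp 1 / ((d : ℝ) + 1) * (n : ℝ)) ^ (n.choose d) := by
  have hmul : n.choose (d + 1) * (d + 1) = n.choose d * (n - d) := Nat.choose_succ_right_eq n d
  have hpos : 0 < n.choose d := Nat.choose_pos (by lia)
  have hle : n.choose d ≤ n.choose (d + 1) :=
    Nat.le_of_mul_le_mul_right (hmul ▸ Nat.mul_le_mul_left _ (by lia)) d.succ_pos
  have hratio : (n.choose (d + 1) : ℝ) * (d + 1) ≤ n.choose d * n := by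
    exact_mod_cast hmul ▸ Nat.mul_le_mul_left _ (Nat.sub_le n d)
  calc (numAcyclic d n : ℝ)
      ≤ ∑ k ∈ Finset.range (n.choose d + 1), ((n.choose (d + 1)).choose k : ℝ) := by
        exact_mod_cast numAcyclic_le_sum_choose d n
    _ ≤ (Real.exp 1 * n.choose (d + 1) / n.choose d) ^ n.choose d :=
        sum_range_choose_le_pow hpos hle
    _ ≤ (Real.exp 1 / (d + 1) * n) ^ n.choose d := by
        gcongr
        rw [div_mul_eq_mul_div, div_le_div_iff₀ (by positivity) (by positivity), mul_assoc,
          mul_assoc, mul_comm (n : ℝ)]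
        gcongr

end UpperBound

namespace Face

variable {n k d : ℕ}

/-- A face of `{0, …, n-1}` seen as a face of `{0, …, n}`. -/
def castSucc (σ : Face (Fin n) k) : Face (Fin (n + 1)) k :=
  ⟨σ.1.map Fin.castSuccEmb, by rw [Finset.card_map, σ.2]⟩

/-- The cone over a face of `{0, …, n-1}` with apex the last vertex `n` of `{0, …, n}`. -/
def cone (σ : Face (Fin n) k) : Face (Fin (n + 1)) (k + 1) :=
  ⟨Finset.cons (Fin.last n) (σ.1.map Fin.castSuccEmb) (by simp), by
    rw [Finset.card_cons, Finset.card_map, σ.2]⟩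

lemma last_notMem_castSucc (σ : Face (Fin n) k) : Fin.last n ∉ σ.castSucc.1 := by
  simp [castSucc]

lemma last_mem_cone (σ : Face (Fin n) k) : Fin.last n ∈ σ.cone.1 := by
  simp [cone]

lemma castSucc_mem_cone (σ : Face (Fin n) k) (x : Fin n) : x.castSucc ∈ σ.cone.1 ↔ x ∈ σ.1 := by
  simp [cone, (Fin.castSucc_lt_last x).ne]

lemma castSucc_injective : Function.Injective (castSucc : Face (Fin n) k → _) := fun _ _ h =>
  Subtype.ext (Finset.map_injective _ (congrArg Subtype.val h))

lemma erase_last_cone (σ : Face (Fin n) k) : σ.cone.1.erase (Fin.last n) = σ.castSucc.1 := by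
  simp only [cone, Finset.erase_cons, castSucc]

lemma cone_injective : Function.Injective (cone : Face (Fin n) k → _) := fun σ τ h =>
  castSucc_injective <| Subtype.ext <| by rw [← erase_last_cone, h, erase_last_cone]

/-- The faces of `{0, …, n}` are the faces of `{0, …, n-1}` and the cones over these. -/
noncomputable def sumEquiv (n k : ℕ) :
    Face (Fin n) (k + 1) ⊕ Face (Fin n) k ≃ Face (Fin (n + 1)) (k + 1) :=
  Equiv.ofBijective (Sum.elim castSucc cone) <| by
    refine (Fintype.bijective_iff_injective_and_card _).2 ⟨?_, ?_⟩
    · refine castSucc_injective.sumElim cone_injective fun σ τ h => σ.last_notMem_castSucc ?_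
      rw [h]
      exact τ.last_mem_cone
    · rw [Fintype.card_sum, card_face_fin, card_face_fin, card_face_fin, add_comm,
        Nat.choose_succ_succ']

lemma sum_cone {M : Type*} [AddCommMonoid M] (σ : Face (Fin n) k) (f : Fin (n + 1) → M) :
    ∑ x ∈ σ.cone.1, f x = f (Fin.last n) + ∑ x ∈ σ.1, f x.castSucc := by
  simp only [cone, Finset.sum_cons, Finset.sum_map, Fin.coe_castSuccEmb]

lemma boundary_castSucc_castSucc (σ : Face (Fin n) (d + 1)) (τ : Face (Fin n) d) :
    σ.castSucc.boundary τ.castSucc = σ.boundary τ := by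
  simp only [boundary, inducedSign_eq_sum, castSucc, Finset.sum_map, ← Finset.map_erase,
    Finset.map_inj, Finset.filter_map, Finset.card_map]
  rfl

lemma boundary_castSucc_cone (σ : Face (Fin n) (d + 2)) (τ : Face (Fin n) d) :
    σ.castSucc.boundary τ.cone = 0 := by
  have hne : ∀ x, τ.cone.1 ≠ σ.castSucc.1.erase x := fun x h =>
    σ.last_notMem_castSucc (Finset.mem_of_mem_erase (h ▸ τ.last_mem_cone))
  simp [boundary, inducedSign_eq_sum, hne]

lemma cone_eq_erase_castSucc_iff (τ : Face (Fin n) d) (σ : Face (Fin n) (d + 1)) (x : Fin n) :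
    τ.cone.1 = σ.cone.1.erase x.castSucc ↔ τ.1 = σ.1.erase x := by
  simp [Finset.ext_iff, Fin.forall_fin_succ', castSucc_mem_cone, last_mem_cone,
    (Fin.castSucc_lt_last x).ne']

lemma card_filter_castSucc_lt_cone (σ : Face (Fin n) k) (x : Fin n) :
    (σ.cone.1.filter (x.castSucc < ·)).card = (σ.1.filter (x < ·)).card + 1 := by
  simp only [cone]
  rw [Finset.filter_cons_of_pos _ _ _ _ (Fin.castSucc_lt_last x), Finset.card_cons,
    Finset.filter_map, Finset.card_map]
  rfl

/-- The apex is one more vertex of the cone above each vertex of `σ`: hence the sign. -/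
lemma boundary_cone_cone (σ : Face (Fin n) (d + 1)) (τ : Face (Fin n) d) :
    σ.cone.boundary τ.cone = -σ.boundary τ := by
  have hlast : τ.cone.1 ≠ σ.cone.1.erase (Fin.last n) := fun h =>
    Finset.notMem_erase _ _ (h ▸ τ.last_mem_cone)
  have hsign : inducedSign τ.cone σ.cone = -inducedSign τ σ := by
    rw [inducedSign_eq_sum, inducedSign_eq_sum, sum_cone, if_neg hlast, zero_add,
      ← Finset.sum_neg_distrib]
    refine Finset.sum_congr rfl fun x _ => ?_
    rw [card_filter_castSucc_lt_cone, pow_succ, mul_neg_one]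
    simp only [cone_eq_erase_castSucc_iff]
    split_ifs
    exacts [rfl, neg_zero.symm]
  simp [boundary, hsign]

end Face

/-- The two factors count the restrictions to the first `n` vertices and the links of the last
vertex; the faces avoiding the last vertex have no boundary in its link. -/
theorem numAcyclic_mul_le (d n : ℕ) :
    numAcyclic (d + 1) n * numAcyclic d n ≤ numAcyclic (d + 1) (n + 1) := by
  let restrict : (Face (Fin (n + 1)) (d + 1) → ℝ) →ₗ[ℝ] (Face (Fin n) (d + 1) → ℝ) :=
    LinearMap.funLeft ℝ ℝ Face.castSucc
  let link : (Face (Fin (n + 1)) (d + 1) → ℝ) →ₗ[ℝ] (Face (Fin n) d → ℝ) :=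
    -LinearMap.funLeft ℝ ℝ Face.cone
  have restrict_castSucc (σ : Face (Fin n) (d + 2)) :
      restrict σ.castSucc.boundary = σ.boundary := funext σ.boundary_castSucc_castSucc
  have link_castSucc (σ : Face (Fin n) (d + 2)) : link σ.castSucc.boundary = 0 :=
    funext fun τ => neg_eq_zero.2 (σ.boundary_castSucc_cone τ)
  have link_cone (σ : Face (Fin n) (d + 1)) : link σ.cone.boundary = σ.boundary :=
    funext fun τ => neg_eq_iff_eq_neg.2 (σ.boundary_cone_cone τ)
  have h := ncard_acyclicReorientations_mul_le (Face.sumEquiv n (d + 1)) restrict link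
    (a := Face.boundary) link_castSucc
  simp only [Face.sumEquiv, Equiv.ofBijective_apply, Sum.elim_inl, Sum.elim_inr, restrict_castSucc,
    link_cone] at h
  simpa only [numAcyclic_eq_ncard] using h

section Permutations

variable {V : Type*} [LinearOrder V]

lemma Face.exists_lt_eq_pair (σ : Face V 2) : ∃ a b, a < b ∧ σ.1 = {a, b} := by
  obtain ⟨a, b, hab, hσ⟩ := Finset.card_eq_two.1 σ.2
  rcases hab.lt_or_gt with h | h
  exacts [⟨a, b, h, hσ⟩, ⟨b, a, h, hσ.trans (Finset.pair_comm a b)⟩]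

variable [Fintype V]

/-- A vertex weighting `f` as a linear form on `0`-chains, with the sign that makes it take the
value `f b - f a` on the boundary of an edge `{a < b}`. -/
def potential (f : V → ℝ) : (Face V 1 → ℝ) →ₗ[ℝ] ℝ :=
  -∑ τ : Face V 1, (∑ x ∈ τ.1, f x) • LinearMap.proj τ

lemma potential_boundary (f : V → ℝ) (σ : Face V 2) {a b : V} (hab : a < b)
    (hσ : σ.1 = {a, b}) : potential f σ.boundary = f b - f a := by
  have hsum := sum_inducedSign_mul σ (fun s => ∑ x ∈ s, f x)
  have ha : ({a, b} : Finset V).erase a = {b} := by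
    rw [Finset.erase_insert (by simpa using hab.ne)]
  have hb : ({a, b} : Finset V).erase b = {a} := by
    rw [Finset.pair_comm, Finset.erase_insert (by simpa using hab.ne')]
  rw [hσ, Finset.sum_pair hab.ne, ha, hb] at hsum
  simp only [Finset.filter_insert, Finset.filter_singleton, hab, hab.not_gt, lt_irrefl, if_true,
    if_false, Finset.sum_singleton, Finset.card_singleton, Finset.card_empty] at hsum
  have hval : potential f σ.boundary = -∑ τ : Face V 1, inducedSign τ σ * ∑ x ∈ τ.1, f x := by
    simp [potential, Face.boundary, mul_comm]
  rw [hval]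
  linear_combination -hsum

lemma potential_boundary_ne_zero {f : V → ℝ} (hf : f.Injective) (σ : Face V 2) :
    potential f σ.boundary ≠ 0 := by
  obtain ⟨a, b, hab, hσ⟩ := σ.exists_lt_eq_pair
  rw [potential_boundary f σ hab hσ]
  exact sub_ne_zero.2 (hf.ne hab.ne')

end Permutations

lemma perm_eq_of_forall_lt_iff_lt {α : Type*} [LinearOrder α] [WellFoundedLT α]
    {π ρ : Equiv.Perm α}
    (h : ∀ i j, i < j → (π i < π j ↔ ρ i < ρ j)) : π = ρ := by
  have hlt : ∀ i j, π i < π j → ρ i < ρ j := fun i j hij => by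
    rcases lt_trichotomy i j with hlt | rfl | hgt
    · exact (h i j hlt).1 hij
    · exact absurd hij (lt_irrefl _)
    · exact (not_lt.1 (mt (h j i hgt).2 hij.not_gt)).lt_of_ne (ρ.injective.ne hgt.ne')
  have hmono : StrictMono (ρ ∘ π.symm) := fun x y hxy => hlt _ _ (by simpa using hxy)
  have hid : ρ ∘ π.symm = id := (hmono.range_inj strictMono_id).1 <| by
    rw [(ρ.surjective.comp π.symm.surjective).range_eq, Set.range_id]
  exact Equiv.ext fun i => by simpa using (congrFun hid (π i)).symm

theorem factorial_le_numAcyclic_one (n : ℕ) : n.factorial ≤ numAcyclic 1 n := by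
  let weight (π : Equiv.Perm (Fin n)) : Fin n → ℝ := fun i => ((π i : ℕ) : ℝ)
  let signs (π : Equiv.Perm (Fin n)) : Face (Fin n) 2 → ℤˣ :=
    fun σ => if 0 < potential (weight π) σ.boundary then 1 else -1
  have weight_injective (π) : (weight π).Injective :=
    Nat.cast_injective.comp (Fin.val_injective.comp π.injective)
  have signs_mem (π) : signs π ∈ acyclicReorientations ℝ Face.boundary :=
    sign_mem_acyclicReorientations _ (potential_boundary_ne_zero (weight_injective π))
  have signs_pair (π) {i j} (hij : i < j) :
      signs π ⟨{i, j}, Finset.card_pair hij.ne⟩ = 1 ↔ π i < π j := by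
    have hval := potential_boundary (weight π) ⟨{i, j}, Finset.card_pair hij.ne⟩ hij rfl
    simp only [signs, hval, weight, sub_pos, Nat.cast_lt, Fin.val_fin_lt]
    split_ifs with h <;> simp [h]
  have signs_injective : signs.Injective := fun π ρ h =>
    perm_eq_of_forall_lt_iff_lt fun i j hij => by rw [← signs_pair π hij, h, signs_pair ρ hij]
  calc n.factorial = Nat.card (Equiv.Perm (Fin n)) := by simp [Fintype.card_perm]
    _ = (Set.range signs).ncard := by rw [← Nat.card_coe_set_eq,
          Nat.card_range_of_injective signs_injective]
    _ ≤ numAcyclic 1 n := by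
        rw [numAcyclic_eq_ncard]
        exact Set.ncard_le_ncard (Set.range_subset_iff.2 signs_mem)

section LowerBound

lemma one_le_numAcyclic_of_le {d n : ℕ} (h : n ≤ d) : 1 ≤ numAcyclic d n := by
  have : IsEmpty (Face (Fin n) (d + 1)) := by
    rw [← Fintype.card_eq_zero_iff, card_face_fin, Nat.choose_eq_zero_of_lt (Nat.lt_succ_of_le h)]
  rw [numAcyclic_eq_ncard, Nat.one_le_iff_ne_zero, ← Nat.pos_iff_ne_zero, Set.ncard_pos]
  exact ⟨isEmptyElim, fun v _ _ => Subsingleton.elim v 0⟩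

lemma exp_mul_log_sub_one_le_factorial {n : ℕ} (hn : n ≠ 0) :
    Real.exp (n * (Real.log n - 1)) ≤ n.factorial := by
  have hlog : 0 ≤ Real.log n := Real.log_natCast_nonneg n
  have hpi : 0 ≤ Real.log (2 * Real.pi) := Real.log_nonneg (by linarith [Real.two_le_pi])
  rw [← Real.le_log_iff_exp_le (by positivity)]
  linarith [Stirling.le_log_factorial_stirling hn]

/-- The induction step of the lower bound, in logarithmic form: with `N = m + d + 2` it compares
the exponents at `(d + 2, N + 1)` with those at `(d + 2, N)` and `(d + 1, N)`. -/
lemma choose_mul_log_sub_le (d m : ℕ) (H : ℝ) :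
    ((m + d + 3).choose (d + 2) : ℝ) * (Real.log (m + 2) - (H + 1 / (d + 2))) ≤
      (m + d + 2).choose (d + 2) * (Real.log (m + 1) - (H + 1 / (d + 2))) +
        (m + d + 2).choose (d + 1) * (Real.log (m + 2) - H) := by
  have hpascal : ((m + d + 3).choose (d + 2) : ℝ) =
      (m + d + 2).choose (d + 1) + (m + d + 2).choose (d + 2) := by
    exact_mod_cast Nat.choose_succ_succ' (m + d + 2) (d + 1)
  have habsorb : ((m + d + 2).choose (d + 2) : ℝ) * (d + 2) =
      (m + d + 2).choose (d + 1) * (m + 1) := by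
    have h := Nat.choose_succ_right_eq (m + d + 2) (d + 1)
    rw [show m + d + 2 - (d + 1) = m + 1 by omega] at h
    exact_mod_cast h
  have hlog : Real.log (m + 2) - Real.log (m + 1) ≤ 1 / (m + 1) := by
    rw [← Real.log_div (by positivity) (by positivity)]
    refine (Real.log_le_sub_one_of_pos (by positivity)).trans_eq ?_
    field_simp
    ring
  have hincr : ((m + d + 2).choose (d + 2) : ℝ) * (Real.log (m + 2) - Real.log (m + 1)) ≤
      (m + d + 2).choose (d + 1) / (d + 2) := by
    refine (mul_le_mul_of_nonneg_left hlog (Nat.cast_nonneg _)).trans_eq ?_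
    rw [← mul_div_assoc, mul_one, div_eq_div_iff (by positivity) (by positivity), habsorb]
  rw [hpascal]
  linear_combination hincr

lemma exp_choose_mul_le_numAcyclic (d m : ℕ) :
    Real.exp ((m + d + 1).choose (d + 1) * (Real.log (m + 1) - harmonic (d + 1))) ≤
      numAcyclic (d + 1) (m + d + 1) := by
  induction d generalizing m with
  | zero =>
    have hfact : ((m + 1).factorial : ℝ) ≤ numAcyclic 1 (m + 1) := by
      exact_mod_cast factorial_le_numAcyclic_one (m + 1)
    simpa [harmonic_succ] using (exp_mul_log_sub_one_le_factorial m.succ_ne_zero).trans hfact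
  | succ d ihd =>
    induction m with
    | zero =>
      have hone : (1 : ℝ) ≤ numAcyclic (d + 2) (d + 2) := by
        exact_mod_cast one_le_numAcyclic_of_le (le_refl (d + 2))
      have hharmonic : (0 : ℝ) ≤ (harmonic (d + 2) : ℚ) := by
        exact_mod_cast (harmonic_pos (d + 1).succ_ne_zero).le
      rw [show 0 + (d + 1) + 1 = d + 2 by ring, Nat.choose_self]
      refine (Real.exp_le_one_iff.2 ?_).trans hone
      rw [Nat.cast_one, one_mul, Nat.cast_zero, zero_add, Real.log_one]
      linarith
    | succ m ihm =>
      have hmul : (numAcyclic (d + 2) (m + d + 2) : ℝ) * numAcyclic (d + 1) (m + d + 2) ≤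
          numAcyclic (d + 2) (m + d + 3) := by
        exact_mod_cast numAcyclic_mul_le (d + 1) (m + d + 2)
      have hlink := ihd (m + 1)
      rw [show m + 1 + d + 1 = m + d + 2 by ring] at hlink
      rw [show m + (d + 1) + 1 = m + d + 2 by ring] at ihm
      rw [show m + 1 + (d + 1) + 1 = m + d + 3 by ring]
      refine le_trans ?_ ((mul_le_mul ihm hlink (by positivity) (by positivity)).trans hmul)
      rw [← Real.exp_add, Real.exp_le_exp]
      have hstep := choose_mul_log_sub_le d m (harmonic (d + 1) : ℚ)
      rw [harmonic_succ (d + 1)]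
      push_cast
      simpa only [add_assoc, one_add_one_eq_two, one_div] using hstep

/-- The truncated subtraction is harmless: for `n < d` the exponent is `0`. -/
theorem pow_choose_le_numAcyclic {d : ℕ} (hd : 1 ≤ d) (n : ℕ) :
    ((((n - d : ℕ) : ℝ) + 1) / Real.exp (harmonic d : ℚ)) ^ n.choose d ≤ numAcyclic d n := by
  rcases lt_or_ge n d with hn | hn
  · rw [Nat.choose_eq_zero_of_lt hn, pow_zero]
    exact_mod_cast one_le_numAcyclic_of_le hn.le
  · obtain ⟨d, rfl⟩ := Nat.exists_eq_add_of_le' hd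
    obtain ⟨m, rfl⟩ := Nat.exists_eq_add_of_le' hn
    have hm : (0 : ℝ) < m + 1 := by positivity
    have h := exp_choose_mul_le_numAcyclic d m
    rw [Real.exp_nat_mul, Real.exp_sub, Real.exp_log hm] at h
    rwa [Nat.add_sub_cancel]

theorem exists_tendsto_pow_choose_le_numAcyclic {d : ℕ} (hd : 1 ≤ d) :
    ∃ η : ℕ → ℝ, Tendsto η atTop (𝓝 0) ∧
      ∀ n : ℕ, 0 < Real.exp ((harmonic d : ℚ) : ℝ) + η n ∧
        ((n : ℝ) / (Real.exp ((harmonic d : ℚ) : ℝ) + η n)) ^ n.choose d ≤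
          (numAcyclic d n : ℝ) := by
  set E := Real.exp ((harmonic d : ℚ) : ℝ) with hE
  have hE0 : 0 < E := Real.exp_pos _
  have hd1 : (0 : ℝ) ≤ d - 1 := sub_nonneg.2 (Nat.one_le_cast.2 hd)
  refine ⟨fun n => E * (d - 1) * (1 / (((n - d : ℕ) : ℝ) + 1)), ?_, fun n => ⟨by positivity, ?_⟩⟩
  · simpa using (tendsto_one_div_add_atTop_nhds_zero_nat.comp
      (tendsto_sub_atTop_nat d)).const_mul (E * (d - 1))
  · refine Eq.trans_le ?_ (pow_choose_le_numAcyclic hd n)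
    rcases lt_or_ge n d with hn | hn
    · rw [Nat.choose_eq_zero_of_lt hn, pow_zero, pow_zero]
    · obtain ⟨m, rfl⟩ := Nat.exists_eq_add_of_le' hn
      have hden : E + E * (d - 1) * (1 / ((m : ℝ) + 1)) = E * (m + d) / (m + 1) := by
        field_simp
        ring
      simp only [Nat.add_sub_cancel]
      rw [hden, ← hE]
      congr 1
      push_cast
      field_simp

theorem eventually_mul_pow_choose_le_numAcyclic {d : ℕ} (hd : 1 ≤ d) {c : ℝ} (hc₀ : 0 ≤ c)
    (hc : c < Real.exp (-(harmonic d : ℚ))) :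
    ∀ᶠ n : ℕ in atTop, (c * n) ^ n.choose d ≤ (numAcyclic d n : ℝ) := by
  set q := Real.exp (-((harmonic d : ℚ) : ℝ)) with hq
  filter_upwards [eventually_ge_atTop d,
    tendsto_natCast_atTop_atTop.eventually_ge_atTop (d * q / (q - c))] with n hnd hn
  refine (pow_le_pow_left₀ (by positivity) ?_ _).trans (pow_choose_le_numAcyclic hd n)
  rw [div_le_iff₀ (sub_pos.2 hc)] at hn
  have hq0 : 0 < q := Real.exp_pos _
  rw [div_eq_mul_inv, ← Real.exp_neg, ← hq, Nat.cast_sub hnd]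
  linear_combination hn + hq0

lemma tendsto_mul_exp_neg_harmonic :
    Tendsto (fun d : ℕ => (d : ℝ) * Real.exp (-((harmonic d : ℚ) : ℝ))) atTop
      (𝓝 (Real.exp (-Real.eulerMascheroniConstant))) := by
  refine ((Real.continuous_exp.tendsto _).comp Real.tendsto_harmonic_sub_log.neg).congr' ?_
  filter_upwards [eventually_gt_atTop 0] with d hd
  rw [Function.comp_apply, neg_sub, sub_eq_add_neg, Real.exp_add, Real.exp_log (by positivity)]

/-- The factor `d / (d + 1)` in the witness is there only to make the upper bound strict. -/
lemma exists_tendsto_div_lt_exp_neg_harmonic :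
    ∃ δ : ℕ → ℝ, Tendsto δ atTop (𝓝 0) ∧ ∀ d : ℕ, 1 ≤ d →
      0 ≤ (Real.exp (-Real.eulerMascheroniConstant) + δ d) / d ∧
      (Real.exp (-Real.eulerMascheroniConstant) + δ d) / d < Real.exp (-(harmonic d : ℚ)) := by
  refine ⟨fun d => (d : ℝ) * Real.exp (-((harmonic d : ℚ) : ℝ)) * (d / (d + 1)) -
    Real.exp (-Real.eulerMascheroniConstant), ?_, fun d hd => ?_⟩
  · simpa using (tendsto_mul_exp_neg_harmonic.mul (tendsto_natCast_div_add_atTop (1 : ℝ))).sub_const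
      (Real.exp (-Real.eulerMascheroniConstant))
  · have hd0 : (0 : ℝ) < d := by exact_mod_cast hd
    have hfactor : (d : ℝ) / (d + 1) < 1 := (div_lt_one (by positivity)).2 (lt_add_one _)
    rw [add_sub_cancel, mul_assoc, mul_div_cancel_left₀ _ hd0.ne']
    exact ⟨by positivity, mul_lt_of_lt_one_right (Real.exp_pos _) hfactor⟩

end LowerBound

theorem mainTheorem1 :
    -- upper bound
    (∀ d : ℕ, 1 ≤ d → ∀ᶠ n : ℕ in atTop,
      (numAcyclic d n : ℝ) ≤ (Real.exp 1 / ((d : ℝ) + 1) * (n : ℝ)) ^ (n.choose d)) ∧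
    -- lower bound, with `η n` the error term `o_n(1)`
    (∀ d : ℕ, 1 ≤ d → ∃ η : ℕ → ℝ, Tendsto η atTop (𝓝 0) ∧
      ∀ n : ℕ, 0 < Real.exp ((harmonic d : ℚ) : ℝ) + η n ∧
        ((n : ℝ) / (Real.exp ((harmonic d : ℚ) : ℝ) + η n)) ^ (n.choose d) ≤
          (numAcyclic d n : ℝ)) ∧
    -- lower bound for large `d`, with `δ d` the error term `o_d(1)`
    (∃ δ : ℕ → ℝ, Tendsto δ atTop (𝓝 0) ∧ ∀ d : ℕ, 1 ≤ d → ∀ᶠ n : ℕ in atTop,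
      ((Real.exp (-Real.eulerMascheroniConstant) + δ d) / (d : ℝ) * (n : ℝ)) ^ (n.choose d) ≤
        (numAcyclic d n : ℝ)) := by
  obtain ⟨δ, hδ, hlt⟩ := exists_tendsto_div_lt_exp_neg_harmonic
  exact ⟨fun d _ => (eventually_ge_atTop (2 * d + 1)).mono fun _ hn => numAcyclic_le hn,
    fun _ hd => exists_tendsto_pow_choose_le_numAcyclic hd,
    δ, hδ, fun d hd =>
      eventually_mul_pow_choose_le_numAcyclic hd (hlt d hd).1 (hlt d hd).2⟩
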